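/- Let $G$ be an exponential Lie group (a real Lie group whose exponential map is a diffeomorphism from the Lie algebra onto $G$), $H\le G$ a closed subgroup, $X=G/H$ the space of left cosets with projection $p:G\to X$, and $dx$ a non-zero $G$-invariant measure on $X$ that is finite on compact sets. Suppose that $H$ has the complemented commutator property, i.e. there is a continuous section $s:X\to G$ of $p$ with $$p(s(x)^{-1}g\,s(x))=p(g)\qquad\text{for all }x\in X,\ g\in G,$$ and fix such an $s$; thus $g^{-1}s(x)^{-1}g\,s(x)\in H$. Let $\chi:H\to\mathbb T$ be a continuous unitary character. For $k\in L^1(X)$ put $$k^{\frown}(g)=\int_X k(x)\,\chi\bigl(g^{-1}s(x)^{-1}g\,s(x)\bigr)\,dx,\qquad g\in G.$$ Let $L^2_\chi(G)$ be the space of functions $F$ on $G$ with $F(gh)=\chi(h)F(g)$ for $h\in H$ and $\int_X|F(s(x))|^2dx<\infty$, on which $G$ acts by the left translations $F\mapsto F(g^{-1}\,\cdot\,)$ (the representation of $G$ induced from $\chi$). Let $\pi_\chi$ be a strongly continuous irreducible unitary representation of $G$ in a complex Hilbert space $V$ that is induced from $\chi$, in the sense that it is unitarily equivalent to the restriction of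 this action to a closed invariant subspace of $L^2_\chi(G)$. Suppose that $\pi_\chi$ is square integrable modulo $H$, and let $\phi\in V$, $\|\phi\|=1$, be an admissible vector: for every $v\in V$ the modulus of $[W_\phi v](g)=\langle v,\pi_\chi(g)\phi\rangle$ depends only on the coset $gH$ and is square integrable over $X$. Put $\Phi=W_\phi\phi$ and assume that $\Phi(s(x))\ne0$ for all $x\in X$. Let $f:X\to\mathbb C$ be such that $f\Phi^{-1}:x\mapsto f(x)\,\Phi(s(x))^{-1}$ is integrable on $X$. Then the relative convolution $$\pi_\chi(f)=\int_X f(x)\,\pi_\chi(s(x))\,dx$$ converges absolutely on each vector of $V$ and is a bounded operator, $(f\Phi^{-1})^{\frown}$ is a bounded function on $G$, and $$\|\pi_\chi(f)\|\le\bigl\|(f\Phi^{-1})^{\frown}\bigr\|_\infty=\sup_{g\in G}\bigl|(f\Phi^{-1})^{\frown}(g)\bigr| .$$ -/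

import Mathlib

open MeasureTheory
open scoped Manifold ContDiff

noncomputable section

namespace RelConv

/-! ### Exponential Lie groups -/

section Exponential

/-- A real Lie group `G`, modelled on `E`, is exponential if its exponential map is a diffeomorphism
from the Lie algebra onto `G`. The Lie algebra is the tangent space of `G` at the identity, which as
a vector space is the model space `E`. The exponential map is the map `e` for which `t ↦ e (t • v)`
is, for each `v`, the one-parameter subgroup with velocity `v` at `t = 0`. -/
def IsExponential (E : Type*) [NormedAddCommGroup E] [NormedSpace ℝ E]
    (G : Type*) [TopologicalSpace G] [ChartedSpace E G] [Group G] : Prop :=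
  ∃ e : Diffeomorph 𝓘(ℝ, E) 𝓘(ℝ, E) E G ∞, ∀ v : TangentSpace 𝓘(ℝ, E) (1 : G),
    (∀ t u : ℝ, e ((t + u) • v) = e (t • v) * e (u • v)) ∧
    HasMFDerivAt 𝓘(ℝ, ℝ) 𝓘(ℝ, E) (fun t : ℝ => e (t • v)) 0
      (ContinuousLinearMap.toSpanSingleton ℝ v)

end Exponential

/-! ### Sections and the complemented commutator property -/

section Sections

variable {G : Type*} [Group G] [TopologicalSpace G] {H : Subgroup G}

/-- `s` is a continuous section of the projection `p : G → X = G ⧸ H`. -/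
def IsContSection (s : G ⧸ H → G) : Prop :=
  Continuous s ∧ ∀ x : G ⧸ H, ((s x : G) : G ⧸ H) = x

/-- `s` is a continuous section with `p (s(x)⁻¹ g s(x)) = p g` for all `x` and `g`. The subgroup
`H` has the complemented commutator property if such an `s` exists. -/
def IsCommutatorSection (s : G ⧸ H → G) : Prop :=
  IsContSection s ∧
    ∀ (x : G ⧸ H) (g : G), (((s x)⁻¹ * g * s x : G) : G ⧸ H) = ((g : G) : G ⧸ H)

/-- The element `s(gH)⁻¹ g` of `H`. -/
def cosetPart {s : G ⧸ H → G} (hs : IsContSection s) (g : G) : H :=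
  ⟨(s (g : G ⧸ H))⁻¹ * g, QuotientGroup.eq.mp (hs.2 _)⟩

/-- The element `h(x, g) = g⁻¹ s(x)⁻¹ g s(x)` of `H`. -/
def commPart {s : G ⧸ H → G} (hs : IsCommutatorSection s) (x : G ⧸ H) (g : G) : H :=
  ⟨g⁻¹ * (s x)⁻¹ * g * s x, by
    have h := QuotientGroup.eq.mp (hs.2 x g).symm
    simpa only [mul_assoc] using h⟩

/-- The transform `k^⌢(g) = ∫_X k(x) χ(g⁻¹ s(x)⁻¹ g s(x)) dx`. -/
def frown [MeasurableSpace (G ⧸ H)] {s : G ⧸ H → G} (hs : IsCommutatorSection s) (χ : H →ₜ* Circle)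
    (μ : Measure (G ⧸ H)) (k : G ⧸ H → ℂ) (g : G) : ℂ :=
  ∫ x, k x * (χ (commPart hs x g) : ℂ) ∂μ

/-- The function `F` on `G` with `F (g h) = χ h * F g` for `h ∈ H` and `F (s x) = f x`. This
identifies functions on `X` with the `χ`-equivariant functions on `G`. -/
def equivariantLift {s : G ⧸ H → G} (hs : IsContSection s) (χ : H →ₜ* Circle)
    (f : G ⧸ H → ℂ) (g : G) : ℂ :=
  (χ (cosetPart hs g) : ℂ) * f (g : G ⧸ H)

theorem equivariantLift_mul {s : G ⧸ H → G} (hs : IsContSection s) (χ : H →ₜ* Circle)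
    (f : G ⧸ H → ℂ) (g : G) (h : H) :
    equivariantLift hs χ f (g * h) = (χ h : ℂ) * equivariantLift hs χ f g := by
  have e : ((g * h : G) : G ⧸ H) = (g : G ⧸ H) := by simp
  have e2 : cosetPart hs (g * h) = cosetPart hs g * h := by
    apply Subtype.ext
    simp [cosetPart, mul_assoc]
  rw [equivariantLift, equivariantLift, e2, e, map_mul, Circle.coe_mul]
  ring

theorem equivariantLift_section {s : G ⧸ H → G} (hs : IsContSection s) (χ : H →ₜ* Circle)
    (f : G ⧸ H → ℂ) (x : G ⧸ H) : equivariantLift hs χ f (s x) = f x := by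
  have e2 : cosetPart hs (s x) = 1 := by
    apply Subtype.ext
    simp [cosetPart, hs.2 x]
  rw [equivariantLift, e2, hs.2 x, map_one, Circle.coe_one, one_mul]

end Sections

/-! ### Unitary representations -/

section Representations

variable {G : Type*} [Group G] [TopologicalSpace G]
variable {V : Type*} [NormedAddCommGroup V] [InnerProductSpace ℂ V]

/-- The unitary representation `π` is strongly continuous and (topologically) irreducible. -/
structure IsIrreducibleRep (π : G →* (V ≃ₗᵢ[ℂ] V)) : Prop where
  continuous : ∀ v : V, Continuous fun g : G => π g v
  nontrivial : Nontrivial V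
  eq_bot_or_top : ∀ W : Submodule ℂ V, IsClosed (W : Set V) →
    (∀ g : G, ∀ v ∈ W, π g v ∈ W) → W = ⊥ ∨ W = ⊤

/-- The wavelet transform `[W_φ v](g) = ⟨v, π(g) φ⟩`, the scalar product being linear in its left
argument (Mathlib's `inner` is linear in the right one). -/
def wavelet (π : G →* (V ≃ₗᵢ[ℂ] V)) (φ v : V) (g : G) : ℂ :=
  inner ℂ (π g φ) v

variable {H : Subgroup G} [MeasurableSpace (G ⧸ H)]

/-- `φ` is an admissible vector for `π` modulo `H`, so that `π` is square integrable modulo `H`: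
for every `v` the modulus of the matrix coefficient `g ↦ ⟨v, π(g) φ⟩` is a function on `X = G ⧸ H`,
and it is square integrable there. -/
structure IsAdmissibleMod (π : G →* (V ≃ₗᵢ[ℂ] V)) (s : G ⧸ H → G) (μ : Measure (G ⧸ H))
    (φ : V) : Prop where
  ne_zero : φ ≠ 0
  norm_mul : ∀ (v : V) (g : G) (h : H), ‖wavelet π φ v (g * h)‖ = ‖wavelet π φ v g‖
  memLp : ∀ v : V, MemLp (fun x => wavelet π φ v (s x)) 2 μ

/-- `π` is (a component of) the representation of `G` induced from `χ`: it is unitarily equivalent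
to the restriction to an invariant subspace of the action of `G` by left translations
`F ↦ F (g⁻¹ ·)` on the space `L²_χ(G)` of functions `F` with `F (g h) = χ h * F g` that are square
integrable over `X = G ⧸ H`. Here `L²_χ(G)` is identified with `L²(X)` by `F ↦ F ∘ s`. -/
def IsInducedFrom {s : G ⧸ H → G} (hs : IsContSection s) (χ : H →ₜ* Circle)
    (μ : Measure (G ⧸ H)) (π : G →* (V ≃ₗᵢ[ℂ] V)) : Prop :=
  ∃ J : V →ₗᵢ[ℂ] Lp ℂ 2 μ, ∀ (g : G) (v : V),
    (J (π g v) : G ⧸ H → ℂ) =ᵐ[μ] fun x => equivariantLift hs χ (J v : G ⧸ H → ℂ) (g⁻¹ * s x)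

/-- The bounded operator `T` is the relative convolution `π(f) = ∫_X f(x) π(s(x)) dx`, the integral
being absolutely convergent on each vector. -/
def IsRelativeConvolution (π : G →* (V ≃ₗᵢ[ℂ] V)) (s : G ⧸ H → G) (μ : Measure (G ⧸ H))
    (f : G ⧸ H → ℂ) (T : V →L[ℂ] V) : Prop :=
  ∀ v : V, Integrable (fun x => f x • π (s x) v) μ ∧ T v = ∫ x, f x • π (s x) v ∂μ

end Representations

end RelConv

end

/-!
The section identity `p(s(x)⁻¹ g s(x)) = p(g)` makes `H` a normal subgroup and `X = G ⧸ H` an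
abelian group, so that the invariant measure of `X` is a Haar measure that is also invariant under
inversion.

The subgroup `H` acts on `V` by the scalars `χ(h)⁻¹` (`map_eq_char_inv_smul`). Indeed an admissible
vector `φ` is an eigenvector of `H`, because `|⟨v, π(h) φ⟩| = |⟨v, φ⟩|` for all `v`. In `L²_χ(G)` an
element `h` acts as the multiplication by `x ↦ χ(s(x)⁻¹ h⁻¹ s(x))`, so the function representing `φ`
lives on a level set of the map sending `x` to the conjugate of `χ` by `s(x)`. This set has positive
measure, so by Steinhaus' theorem the stabilizer of `χ` is an open subgroup of the connected group
`G`, that is, all of `G`. Hence `H` acts on `φ` by `χ⁻¹`, and then on all of `V` by irreducibility.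

Consequently `π(g)` and `π(s(x))` commute up to the factor `χ(g⁻¹ s(x)⁻¹ g s(x))`, and products
`W_φ u · conj (W_φ' v)` are functions on `X`. By Schur's lemma `⟨W_φ u, W_φ v⟩ = C ⟨u, v⟩`
(`exists_inner_waveletL2_eq`), and the same lemma for the pair `φ`, `π(s(x))⁻¹ φ` gives
`∫ χ(g⁻¹ s(x)⁻¹ g s(x)) W_φ u(g) conj (W_φ v(g)) dg = C Φ(s(x)) ⟨π(s(x)) u, v⟩`
(`integral_char_commPart_mul_wavelet`). Integrating against `k = f Φ⁻¹`, Fubini's theorem yields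
`C ⟨π(f) u, v⟩ = ∫ k^⌢ · W_φ u · conj (W_φ v)` (`inner_relativeConvolution`). Thus `π(f)` is the
compression of the multiplication by `k^⌢` along the isometry `C^(-1/2) W_φ`, which gives the norm
bound.
-/

namespace RelConv

/-! ### Schur's lemma -/

section Schur

variable {G : Type*} [Group G]
variable {V : Type*} [NormedAddCommGroup V] [InnerProductSpace ℂ V]

theorem map_mul_apply (π : G →* (V ≃ₗᵢ[ℂ] V)) (a b : G) (v : V) : π (a * b) v = π a (π b v) := by
  rw [map_mul]; rfl

theorem map_inv_map_apply (π : G →* (V ≃ₗᵢ[ℂ] V)) (a : G) (v : V) : π a⁻¹ (π a v) = v := by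
  rw [← map_mul_apply, inv_mul_cancel, map_one]; rfl

theorem inner_map_left_eq (π : G →* (V ≃ₗᵢ[ℂ] V)) (g : G) (u v : V) :
    inner ℂ (π g u) v = inner ℂ u (π g⁻¹ v) := by
  rw [← (π g⁻¹).inner_map_map (π g u) v, map_inv_map_apply]

variable [TopologicalSpace G] [CompleteSpace V]

/-- If the spectrum contained two points, continuous functions with disjoint supports around them
would give two nonzero operators with product zero, and the kernel of one of them would be a proper
closed invariant subspace. -/
theorem IsIrreducibleRep.exists_eq_smul_of_isSelfAdjoint {π : G →* (V ≃ₗᵢ[ℂ] V)}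
    (hπ : IsIrreducibleRep π) {A : V →L[ℂ] V} (hA : IsSelfAdjoint A)
    (hcomm : ∀ g v, A (π g v) = π g (A v)) : ∃ c : ℂ, ∀ v, A v = c • v := by
  have := hπ.nontrivial
  have hcfc : ∀ (q : ℝ → ℝ) (g : G) (v : V), cfc q A (π g v) = π g (cfc q A v) := by
    intro q g v
    have h1 : Commute A ((π g).toContinuousLinearEquiv : V →L[ℂ] V) := by
      ext v; simpa using hcomm g v
    simpa using DFunLike.congr_fun (h1.cfc_real q).eq v
  obtain ⟨c, hc⟩ := ContinuousFunctionalCalculus.spectrum_nonempty (R := ℝ) A hA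
  have hle : ∀ c ∈ spectrum ℝ A, ∀ d ∈ spectrum ℝ A, ¬ c < d := by
    intro c hc d hd hcd
    let m := (c + d) / 2
    let p : ℝ → ℝ := fun x => max 0 (m - x)
    let q : ℝ → ℝ := fun x => max 0 (x - m)
    have hpc : Continuous p := by fun_prop
    have hqc : Continuous q := by fun_prop
    have hne : ∀ r : ℝ → ℝ, Continuous r → ∀ a ∈ spectrum ℝ A, r a ≠ 0 → cfc r A ≠ 0 := by
      intro r hr a ha hra h0
      have h1 := cfc_map_spectrum r A (ha := hA) (hf := hr.continuousOn)
      rw [h0, spectrum.zero_eq] at h1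
      have : r a ∈ ({0} : Set ℝ) := h1 ▸ ⟨a, ha, rfl⟩
      exact hra this
    have hp0 : cfc p A ≠ 0 := hne p hpc c hc (by
      have : 0 < m - c := by simp only [m]; linarith
      simp only [p]; rw [max_eq_right this.le]; exact this.ne')
    have hq0 : cfc q A ≠ 0 := hne q hqc d hd (by
      have : 0 < d - m := by simp only [m]; linarith
      simp only [q]; rw [max_eq_right this.le]; exact this.ne')
    have hpq : cfc p A * cfc q A = 0 := by
      rw [← cfc_mul p q A hpc.continuousOn hqc.continuousOn]
      have : (fun x => p x * q x) = fun _ => 0 := by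
        funext x
        simp only [p, q]
        rcases le_total x m with h | h
        · rw [max_eq_left (a := 0) (b := x - m) (by linarith), mul_zero]
        · rw [max_eq_left (a := 0) (b := m - x) (by linarith), zero_mul]
      rw [this, cfc_const_zero]
    rcases hπ.eq_bot_or_top (LinearMap.ker (cfc p A : V →L[ℂ] V).toLinearMap)
      (ContinuousLinearMap.isClosed_ker _)
      (fun g v hv => by
        have hv' : cfc p A v = 0 := hv
        change cfc p A (π g v) = 0
        rw [hcfc, hv', map_zero]) with h | h
    · apply hq0
      ext v
      have : cfc q A v ∈ LinearMap.ker (cfc p A : V →L[ℂ] V).toLinearMap :=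
        DFunLike.congr_fun hpq v
      rw [h] at this
      simpa using this
    · apply hp0
      ext v
      have : v ∈ LinearMap.ker (cfc p A : V →L[ℂ] V).toLinearMap := by rw [h]; trivial
      exact this
  have hsub : spectrum ℝ A ⊆ {c} := fun d hd =>
    le_antisymm (not_lt.1 (hle c hc d hd)) (not_lt.1 (hle d hd c hc))
  have hAc := CFC.eq_algebraMap_of_spectrum_subset_singleton A c hsub hA
  refine ⟨c, fun v => ?_⟩
  conv_lhs => rw [hAc, Algebra.algebraMap_eq_smul_one]
  simp

theorem IsIrreducibleRep.exists_eq_smul {π : G →* (V ≃ₗᵢ[ℂ] V)}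
    (hπ : IsIrreducibleRep π) {A : V →L[ℂ] V}
    (hcomm : ∀ g v, A (π g v) = π g (A v)) : ∃ c : ℂ, ∀ v, A v = c • v := by
  have hreal : ∀ g (r : ℝ) v, π g (r • v) = r • π g v := fun g r v =>
    (π g).toLinearEquiv.toLinearMap.map_smul_of_tower r v
  have hstar : ∀ g v, (star A) (π g v) = π g (star A v) := by
    intro g v
    refine ext_inner_right ℂ fun w => ?_
    rw [ContinuousLinearMap.star_eq_adjoint, ContinuousLinearMap.adjoint_inner_left,
      inner_map_left_eq, inner_map_left_eq, ContinuousLinearMap.adjoint_inner_left, hcomm]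
  obtain ⟨a, ha⟩ := hπ.exists_eq_smul_of_isSelfAdjoint (A := (realPart A : V →L[ℂ] V))
    (realPart A).2 (fun g v => by simp [realPart_apply_coe, hcomm, hstar, hreal])
  obtain ⟨b, hb⟩ := hπ.exists_eq_smul_of_isSelfAdjoint (A := (imaginaryPart A : V →L[ℂ] V))
    (imaginaryPart A).2 (fun g v => by simp [imaginaryPart_apply_coe, hcomm, hstar, hreal])
  refine ⟨a + Complex.I * b, fun v => ?_⟩
  conv_lhs => rw [← realPart_add_I_smul_imaginaryPart A]
  simp [ha, hb, add_smul, mul_smul]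

/-- Schur's lemma for a bounded invariant sesquilinear form, given as `(v, u) ↦ ⟪W' v, W u⟫`. -/
theorem IsIrreducibleRep.exists_inner_eq {π : G →* (V ≃ₗᵢ[ℂ] V)} (hπ : IsIrreducibleRep π)
    {K : Type*} [NormedAddCommGroup K] [InnerProductSpace ℂ K] [CompleteSpace K]
    (W W' : V →L[ℂ] K)
    (h : ∀ g u v, inner ℂ (W' v) (W (π g u)) = inner ℂ (W' (π g⁻¹ v)) (W u)) :
    ∃ c : ℂ, ∀ u v, inner ℂ (W' v) (W u) = c * inner ℂ v u := by
  obtain ⟨c, hc⟩ := hπ.exists_eq_smul (A := W'.adjoint.comp W) (fun g u => by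
    refine ext_inner_left ℂ fun v => ?_
    have h1 := inner_map_left_eq π g⁻¹ v (W'.adjoint.comp W u)
    rw [inv_inv] at h1
    rw [← h1, ContinuousLinearMap.comp_apply, ContinuousLinearMap.comp_apply,
      ContinuousLinearMap.adjoint_inner_right, ContinuousLinearMap.adjoint_inner_right, h])
  refine ⟨c, fun u v => ?_⟩
  rw [← inner_smul_right, ← hc, ContinuousLinearMap.comp_apply,
    ContinuousLinearMap.adjoint_inner_right]

end Schur

/-! ### The wavelet transform as a bounded operator -/

section Wavelet

open ComplexConjugate

variable {G : Type*} [Group G] {H : Subgroup G} [MeasurableSpace (G ⧸ H)]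
variable {V : Type*} [NormedAddCommGroup V] [InnerProductSpace ℂ V]
variable {π : G →* (V ≃ₗᵢ[ℂ] V)} {s : G ⧸ H → G} {μ : Measure (G ⧸ H)} {ψ ψ' : V}

theorem wavelet_map (π : G →* (V ≃ₗᵢ[ℂ] V)) (ψ v : V) (a g : G) :
    wavelet π ψ (π a v) g = wavelet π ψ v (a⁻¹ * g) := by
  rw [wavelet, wavelet, map_mul_apply, inner_map_left_eq π a⁻¹, inv_inv]

theorem continuous_wavelet [TopologicalSpace G] (hπ : IsIrreducibleRep π) (ψ v : V) :
    Continuous (wavelet π ψ v) :=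
  (hπ.continuous ψ).inner continuous_const

variable [CompleteSpace V]

/-- The wavelet transform `v ↦ W_ψ v`, read on `X` through the section `s`, as a bounded operator
from `V` to `L²(X)`. Boundedness is automatic by the closed graph theorem. -/
noncomputable def waveletL2 (hψ : ∀ v, MemLp (fun x => wavelet π ψ v (s x)) 2 μ) :
    V →L[ℂ] Lp ℂ 2 μ :=
  let W : V →ₗ[ℂ] Lp ℂ 2 μ :=
    { toFun := fun v => (hψ v).toLp
      map_add' := fun u v => by
        rw [← MemLp.toLp_add]
        congr 1
        funext x
        simp [wavelet]
      map_smul' := fun c v => by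
        rw [RingHom.id_apply, ← MemLp.toLp_const_smul]
        congr 1
        funext x
        simp [wavelet] }
  { W with
    cont := W.continuous_of_seq_closed_graph fun u x y hu hy => by
      obtain ⟨ns, hns, hae⟩ :=
        (tendstoInMeasure_of_tendsto_Lp hy).exists_seq_tendsto_ae
      refine Lp.ext ?_
      have h1 : ∀ᵐ z ∂μ, ∀ n, (W (u n)) z = wavelet π ψ (u n) (s z) :=
        ae_all_iff.2 fun n => (hψ (u n)).coeFn_toLp
      filter_upwards [hae, h1, (hψ x).coeFn_toLp] with z hz h1 h2
      refine tendsto_nhds_unique hz ?_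
      simp only [Function.comp_apply, h1]
      have : Filter.Tendsto (fun n => wavelet π ψ (u (ns n)) (s z)) Filter.atTop
          (nhds (wavelet π ψ x (s z))) :=
        tendsto_const_nhds.inner (hu.comp hns.tendsto_atTop)
      rw [← h2] at this
      exact this }

theorem coeFn_waveletL2 (hψ : ∀ v, MemLp (fun x => wavelet π ψ v (s x)) 2 μ) (v : V) :
    waveletL2 hψ v =ᵐ[μ] fun x => wavelet π ψ v (s x) :=
  (hψ v).coeFn_toLp

theorem inner_waveletL2 (hψ : ∀ v, MemLp (fun x => wavelet π ψ v (s x)) 2 μ)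
    (hψ' : ∀ v, MemLp (fun x => wavelet π ψ' v (s x)) 2 μ) (u v : V) :
    inner ℂ (waveletL2 hψ' v) (waveletL2 hψ u) =
      ∫ x, wavelet π ψ u (s x) * conj (wavelet π ψ' v (s x)) ∂μ := by
  rw [L2.inner_def]
  refine integral_congr_ae ?_
  filter_upwards [coeFn_waveletL2 hψ u, coeFn_waveletL2 hψ' v] with x h1 h2
  rw [h1, h2, RCLike.inner_apply]

/-- A right `H`-invariant function on `G` has the same integral over `X` as its left translates. -/
theorem integral_section_translate [TopologicalSpace G] [BorelSpace (G ⧸ H)] [ContinuousMul G]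
    [SMulInvariantMeasure G (G ⧸ H) μ]
    (hs : IsContSection s) {F : G → ℂ} (hF : ∀ (g : G) (h : H), F (g * h) = F g) (a : G) :
    ∫ x, F (a * s x) ∂μ = ∫ x, F (s x) ∂μ := by
  have h1 : ∀ x, F (a * s x) = F (s (a • x)) := by
    intro x
    have h2 : ((a * s x : G) : G ⧸ H) = a • x := by
      conv_rhs => rw [← hs.2 x]
      rfl
    have h3 : (s (a • x))⁻¹ * (a * s x) ∈ H := by
      rw [← QuotientGroup.eq, hs.2, h2]
    simpa using (hF (s (a • x)) ⟨_, h3⟩)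
  simp_rw [h1]
  exact integral_smul_eq_self (μ := μ) (fun x => F (s x)) (g := a)

/-- Orthogonality relations: by Schur's lemma the scalar products of two wavelet transforms are
proportional to the scalar products in `V`. -/
theorem exists_inner_waveletL2_eq [TopologicalSpace G] [BorelSpace (G ⧸ H)] [ContinuousMul G]
    [SMulInvariantMeasure G (G ⧸ H) μ]
    (hs : IsContSection s) (hπ : IsIrreducibleRep π)
    (hψ : ∀ v, MemLp (fun x => wavelet π ψ v (s x)) 2 μ)
    (hψ' : ∀ v, MemLp (fun x => wavelet π ψ' v (s x)) 2 μ)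
    (hH : ∀ (u v : V) (g : G) (h : H), wavelet π ψ u (g * h) * conj (wavelet π ψ' v (g * h)) =
      wavelet π ψ u g * conj (wavelet π ψ' v g)) :
    ∃ c : ℂ, ∀ u v, inner ℂ (waveletL2 hψ' v) (waveletL2 hψ u) = c * inner ℂ v u := by
  refine hπ.exists_inner_eq _ _ fun g u v => ?_
  rw [inner_waveletL2, inner_waveletL2, ← integral_section_translate hs
    (F := fun y => wavelet π ψ (π g u) y * conj (wavelet π ψ' v y)) (hH _ _) g]
  refine integral_congr_ae (Filter.Eventually.of_forall fun x => ?_)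
  simp only [wavelet_map, inv_inv, inv_mul_cancel_left]

end Wavelet

/-! ### The quotient group -/

section Quotient

variable {G : Type*} [Group G] [TopologicalSpace G] {H : Subgroup G} {s : G ⧸ H → G}

theorem IsCommutatorSection.normal (hs : IsCommutatorSection s) : H.Normal where
  conj_mem n hn g := by
    have h1 : (s (g⁻¹ : G))⁻¹ * n * s (g⁻¹ : G) ∈ H := by
      have h2 := hs.2 (g⁻¹ : G) n
      rw [QuotientGroup.eq] at h2
      simpa using H.mul_mem hn (H.inv_mem h2)
    have h3 := (cosetPart hs.1 g⁻¹).2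
    have h4 := H.mul_mem (H.mul_mem (H.inv_mem h3) h1) h3
    simpa [cosetPart, mul_assoc] using h4

theorem IsCommutatorSection.mul_comm [H.Normal] (hs : IsCommutatorSection s) (x y : G ⧸ H) :
    x * y = y * x := by
  obtain ⟨g, rfl⟩ := QuotientGroup.mk_surjective x
  have h := hs.2 y g
  rw [QuotientGroup.mk_mul, QuotientGroup.mk_mul, QuotientGroup.mk_inv, hs.1.2] at h
  calc (g : G ⧸ H) * y = y * (y⁻¹ * g * y) := by group
    _ = y * g := by rw [h]

variable [IsTopologicalGroup G] [MeasurableSpace (G ⧸ H)] [BorelSpace (G ⧸ H)]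
  {μ : Measure (G ⧸ H)} [SMulInvariantMeasure G (G ⧸ H) μ]

theorem isMulLeftInvariant_of_smulInvariantMeasure [H.Normal] : μ.IsMulLeftInvariant where
  map_mul_left_eq_self x := by
    obtain ⟨g, rfl⟩ := QuotientGroup.mk_surjective x
    have h : (fun y : G ⧸ H => (g : G ⧸ H) * y) = fun y => g • y := by
      funext y
      obtain ⟨a, rfl⟩ := QuotientGroup.mk_surjective y
      rfl
    rw [h]
    exact (measurePreserving_smul g μ).map_eq

variable [SecondCountableTopology G] [LocallyCompactSpace G] [IsFiniteMeasureOnCompacts μ]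

theorem isHaarMeasure_quotient [H.Normal] (hH : IsClosed (H : Set G)) (hμ : μ ≠ 0) :
    μ.IsHaarMeasure := by
  have := hH
  have := isMulLeftInvariant_of_smulInvariantMeasure (μ := μ)
  have : NeZero μ := ⟨hμ⟩
  exact {}

theorem isInvInvariant_quotient [H.Normal] (hH : IsClosed (H : Set G)) (hμ : μ ≠ 0)
    (hs : IsCommutatorSection s) : μ.IsInvInvariant := by
  have := hH
  have := isHaarMeasure_quotient hH hμ
  let : CommGroup (G ⧸ H) := { (inferInstance : Group (G ⧸ H)) with mul_comm := hs.mul_comm }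
  exact Measure.IsHaarMeasure.isInvInvariant_of_regular (μ := μ)

end Quotient

/-! ### The subgroup acts by scalars -/

section Scalar

open scoped Pointwise

variable {G : Type*} [Group G] {H : Subgroup G}
variable {V : Type*} [NormedAddCommGroup V] [InnerProductSpace ℂ V]
variable {π : G →* (V ≃ₗᵢ[ℂ] V)} {s : G ⧸ H → G} {φ : V}

/-- An admissible vector is an eigenvector of `H`: as `|⟨v, π(h) φ⟩| = |⟨v, φ⟩|` for all `v`,
equality holds in the Cauchy-Schwarz inequality for `φ` and `π(h) φ`. -/
theorem IsAdmissibleMod.map_eq_smul [MeasurableSpace (G ⧸ H)] {μ : Measure (G ⧸ H)}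
    (hφ : IsAdmissibleMod π s μ φ) (hφ1 : ‖φ‖ = 1) (h : H) :
    π h φ = inner ℂ φ (π h φ) • φ := by
  have h1 := hφ.norm_mul (π h φ) 1 h
  simp only [wavelet, one_mul, map_one, LinearIsometryEquiv.coe_one, id_eq,
    inner_self_eq_norm_sq_to_K] at h1
  have h2 : ‖π h φ‖ = 1 := by rw [LinearIsometryEquiv.norm_map, hφ1]
  have h3 : π h φ ≠ 0 := fun h0 => by simp [h0] at h2
  have h4 : ‖inner ℂ φ (π h φ)‖ = ‖φ‖ * ‖π h φ‖ := by
    rw [← h1, h2, hφ1]; simp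
  obtain ⟨r, -, hr⟩ := (norm_inner_eq_norm_iff hφ.ne_zero h3).1 h4
  rw [hr, inner_smul_right, inner_self_eq_norm_sq_to_K, hφ1]
  simp

variable [TopologicalSpace G]

/-- The conjugate `χ^g : h ↦ χ (g⁻¹ h g)` of a character `χ` of a normal subgroup. -/
noncomputable def conjChar [H.Normal] (χ : H →ₜ* Circle) (g : G) (h : H) : Circle :=
  χ (MulAut.conjNormal g⁻¹ h)

theorem conjChar_mul [H.Normal] (χ : H →ₜ* Circle) (a b : G) (h : H) :
    conjChar χ (a * b) h = conjChar χ b (MulAut.conjNormal a⁻¹ h) := by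
  simp [conjChar]

theorem conjChar_of_mem [H.Normal] (χ : H →ₜ* Circle) (k h : H) :
    conjChar χ (k : G) h = χ h := by
  have : (MulAut.conjNormal (k : G)⁻¹) h = k⁻¹ * h * k := by
    apply Subtype.ext; simp
  rw [conjChar, this, map_mul, map_mul, map_inv, mul_right_comm, inv_mul_cancel, one_mul]

/-- The elements of `G` whose conjugation action fixes the character `χ`. -/
def charStabilizer [H.Normal] (χ : H →ₜ* Circle) : Subgroup G where
  carrier := {g | ∀ h, conjChar χ g h = χ h}
  one_mem' h := by simp [conjChar]
  mul_mem' {a b} ha hb h := by rw [conjChar_mul, hb, ← ha h]; rfl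
  inv_mem' {a} ha h := by
    simpa [conjChar] using (ha (MulAut.conjNormal a h)).symm

theorem le_charStabilizer [H.Normal] (χ : H →ₜ* Circle) : H ≤ charStabilizer χ :=
  fun k hk h => conjChar_of_mem χ ⟨k, hk⟩ h

/-- In the representation induced from `χ` an element `h` of the normal subgroup `H` acts as the
multiplication by `x ↦ χ (s(x)⁻¹ h⁻¹ s(x))`. -/
theorem equivariantLift_inv_mul [H.Normal] (hs : IsContSection s) (χ : H →ₜ* Circle)
    (f : G ⧸ H → ℂ) (h : H) (x : G ⧸ H) :
    equivariantLift hs χ f ((h : G)⁻¹ * s x) = conjChar χ (s x) h⁻¹ * f x := by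
  have h1 : (h : G)⁻¹ * s x = s x * (MulAut.conjNormal (s x)⁻¹ h⁻¹ : H) := by
    simp [mul_assoc]
  rw [h1, equivariantLift_mul, equivariantLift_section]
  rfl

variable [IsTopologicalGroup G]

theorem continuous_conjChar_left [H.Normal] (χ : H →ₜ* Circle) (h : H) :
    Continuous fun g : G => conjChar χ g h := by
  refine χ.continuous_toFun.comp (Continuous.subtype_mk (p := (· ∈ H))
    (f := fun g : G => g⁻¹ * h * g⁻¹⁻¹) ?_ _)
  fun_prop

theorem continuous_conjChar_right [H.Normal] (χ : H →ₜ* Circle) (g : G) :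
    Continuous fun h : H => conjChar χ g h := by
  refine χ.continuous_toFun.comp (Continuous.subtype_mk (p := (· ∈ H))
    (f := fun h : H => g⁻¹ * h * g⁻¹⁻¹) ?_ _)
  fun_prop

variable [SecondCountableTopology G] [LocallyCompactSpace G] [ConnectedSpace G]
variable [MeasurableSpace (G ⧸ H)] [BorelSpace (G ⧸ H)] {μ : Measure (G ⧸ H)}
  [SMulInvariantMeasure G (G ⧸ H) μ] [IsFiniteMeasureOnCompacts μ]

/-- Two points of a level set of `x ↦ χ^{s(x)}` differ by an element of the stabilizer of `χ`. If
the level set has positive measure, the stabilizer is open by Steinhaus' theorem, hence everything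
by connectedness. -/
theorem charStabilizer_eq_top [H.Normal] (hH : IsClosed (H : Set G)) (hμ : μ ≠ 0)
    (hs : IsCommutatorSection s) (χ : H →ₜ* Circle) (c : H → Circle)
    (hc : μ {x | ∀ h, conjChar χ (s x) h = c h} ≠ 0) : charStabilizer χ = ⊤ := by
  have := hH
  have := isHaarMeasure_quotient hH hμ
  set P : Set (G ⧸ H) := {x | ∀ h, conjChar χ (s x) h = c h} with hP
  have hPc : IsClosed P := by
    rw [hP, Set.ofPred_forall]
    exact isClosed_iInter fun h =>
      isClosed_eq ((continuous_conjChar_left χ h).comp hs.1.1) continuous_const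
  have h1 : P / P ∈ nhds (1 : G ⧸ H) :=
    Measure.div_mem_nhds_one_of_haar_pos μ P hPc.measurableSet (pos_iff_ne_zero.2 hc)
  have h2 : ((↑) : G → G ⧸ H) ⁻¹' (P / P) ⊆ (charStabilizer χ : Set G) := by
    rintro g ⟨x, hx, y, hy, hxy⟩
    have h3 : (s y)⁻¹ * s x ∈ charStabilizer χ := by
      intro h
      rw [conjChar_mul, hx, ← hy]
      simp [conjChar]
    have h4 : ((s y)⁻¹ * s x)⁻¹ * g ∈ H := by
      rw [← QuotientGroup.eq, QuotientGroup.mk_mul, QuotientGroup.mk_inv, hs.1.2, hs.1.2, ← hxy,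
        hs.mul_comm]
      exact (div_eq_mul_inv x y).symm
    have h5 := (charStabilizer χ).mul_mem h3 (le_charStabilizer χ h4)
    rwa [mul_inv_cancel_left] at h5
  have h5 : (charStabilizer χ : Set G) ∈ nhds (1 : G) :=
    Filter.mem_of_superset (QuotientGroup.continuous_mk.continuousAt.preimage_mem_nhds h1) h2
  have h6 := Subgroup.isOpen_of_mem_nhds _ h5
  have h7 : IsClopen (charStabilizer χ : Set G) := ⟨Subgroup.isClosed_of_isOpen _ h6, h6⟩
  exact SetLike.coe_injective (h7.eq_univ ⟨1, one_mem _⟩)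

/-- Every `h ∈ H` acts as the scalar `χ(h)⁻¹`. -/
theorem map_eq_char_inv_smul (hH : IsClosed (H : Set G)) (hμ : μ ≠ 0)
    (hs : IsCommutatorSection s) (χ : H →ₜ* Circle) (hπ : IsIrreducibleRep π)
    (hind : IsInducedFrom hs.1 χ μ π) (hφ : IsAdmissibleMod π s μ φ) (hφ1 : ‖φ‖ = 1)
    (h : H) (v : V) : π h v = (χ h⁻¹ : ℂ) • v := by
  have hN := hs.normal
  have : SecondCountableTopology H :=
    TopologicalSpace.Subtype.secondCountableTopology (H : Set G)
  obtain ⟨J, hJ⟩ := hind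
  have hc1 : ∀ h : H, ‖inner ℂ φ (π h φ)‖ = 1 := by
    intro h
    have h1 := congrArg norm (hφ.map_eq_smul hφ1 h)
    rwa [norm_smul, LinearIsometryEquiv.norm_map, hφ1, mul_one, eq_comm] at h1
  -- The eigencharacter of `φ`, precomposed with inversion.
  let c : H → Circle := fun h => ⟨inner ℂ φ (π ((h⁻¹ : H) : G) φ), by
    simpa [Submonoid.unitSphere] using hc1 h⁻¹⟩
  have hc : Continuous c := by
    refine Continuous.subtype_mk ?_ _
    refine continuous_const.inner ((hπ.continuous φ).comp ?_)
    fun_prop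
  have hφc : ∀ h : H, π h φ = (c h⁻¹ : ℂ) • φ := by
    intro h
    simpa [c] using hφ.map_eq_smul hφ1 h
  -- Off the level set of `x ↦ χ^{s(x)}` at the value `c`, the function `J φ` vanishes.
  have hae : ∀ᵐ x ∂μ, J φ x ≠ 0 → ∀ h, conjChar χ (s x) h = c h := by
    have h1 : ∀ᵐ x ∂μ, ∀ n, J φ x ≠ 0 →
        conjChar χ (s x) (TopologicalSpace.denseSeq H n) = c (TopologicalSpace.denseSeq H n) := by
      refine ae_all_iff.2 fun n => ?_
      set h := TopologicalSpace.denseSeq H n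
      have h2 := hJ ((h⁻¹ : H) : G) φ
      rw [hφc, map_smul, inv_inv] at h2
      filter_upwards [h2, Lp.coeFn_smul (c h : ℂ) (J φ)] with x hx hx' hne
      rw [hx', Pi.smul_apply, equivariantLift_inv_mul hs.1 χ, inv_inv, smul_eq_mul] at hx
      exact (Circle.ext (mul_right_cancel₀ hne hx)).symm
    filter_upwards [h1] with x hx hne h
    exact congrFun ((continuous_conjChar_right χ (s x)).ext_on
      (TopologicalSpace.denseRange_denseSeq H) hc
      (by rintro _ ⟨n, rfl⟩; exact hx n hne)) h
  have hpos : μ {x | ∀ h, conjChar χ (s x) h = c h} ≠ 0 := by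
    intro h0
    have h1 : J φ = 0 := by
      refine Lp.ext ?_
      filter_upwards [hae, measure_eq_zero_iff_ae_notMem.1 h0, Lp.coeFn_zero ℂ 2 μ] with x h1 h2 h3
      rw [h3]
      by_contra hne
      exact h2 (h1 hne)
    exact hφ.ne_zero (J.injective (by rw [h1, map_zero]))
  have htop := charStabilizer_eq_top hH hμ hs χ c hpos
  have hinv : ∀ g h, conjChar χ g h = χ h := fun g => by
    have : g ∈ charStabilizer χ := by rw [htop]; trivial
    exact this
  obtain ⟨x, hx⟩ := nonempty_of_measure_ne_zero hpos
  have hcχ : ∀ h, c h = χ h := fun h => by rw [← hx h, hinv]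
  -- The vectors on which `H` acts by `χ⁻¹` form a closed invariant subspace containing `φ`.
  let W : Submodule ℂ V :=
    { carrier := {v | ∀ h : H, π h v = (χ h⁻¹ : ℂ) • v}
      add_mem' := fun {a b} ha hb h => by rw [map_add, ha, hb, smul_add]
      zero_mem' := fun h => by simp
      smul_mem' := fun r a ha h => by rw [map_smul, ha, smul_comm] }
  have hWc : IsClosed (W : Set V) := by
    change IsClosed {v | ∀ h : H, π h v = (χ h⁻¹ : ℂ) • v}
    rw [Set.ofPred_forall]
    exact isClosed_iInter fun h => isClosed_eq (π h).continuous (continuous_const_smul _)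
  have hφW : φ ∈ W := fun h => by rw [hφc, hcχ]
  rcases hπ.eq_bot_or_top W hWc (fun g v hv h => by
    have h1 : (h : G) * g = g * (MulAut.conjNormal g⁻¹ h : H) := by simp [mul_assoc]
    have h2 : χ (MulAut.conjNormal g⁻¹ h)⁻¹ = χ h⁻¹ := by
      rw [← map_inv]; exact hinv g h⁻¹
    rw [← map_mul_apply, h1, map_mul_apply, hv, h2, map_smul]) with hW | hW
  · rw [hW] at hφW
    exact absurd hφW hφ.ne_zero
  · have : v ∈ W := by rw [hW]; trivial
    exact this h

end Scalar

/-! ### The twisted orthogonality relation -/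

section Orthogonality

open ComplexConjugate

variable {G : Type*} [Group G] [TopologicalSpace G] {H : Subgroup G}
variable {V : Type*} [NormedAddCommGroup V] [InnerProductSpace ℂ V]
variable {π : G →* (V ≃ₗᵢ[ℂ] V)} {s : G ⧸ H → G} {φ ψ : V} {χ : H →ₜ* Circle}

theorem wavelet_mul_mem (hsc : ∀ (h : H) (v : V), π h v = (χ h⁻¹ : ℂ) • v) (ψ v : V) (g : G)
    (h : H) : wavelet π ψ v (g * h) = χ h * wavelet π ψ v g := by
  rw [wavelet, map_mul_apply, hsc, map_smul, inner_smul_left, map_inv, Circle.coe_inv_eq_conj,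
    Complex.conj_conj]
  rfl

theorem wavelet_mul_conj_wavelet_mul_mem
    (hsc : ∀ (h : H) (v : V), π h v = (χ h⁻¹ : ℂ) • v) (ψ ψ' u v : V) (g : G) (h : H) :
    wavelet π ψ u (g * h) * conj (wavelet π ψ' v (g * h)) =
      wavelet π ψ u g * conj (wavelet π ψ' v g) := by
  have h1 : (χ h : ℂ) * conj (χ h : ℂ) = 1 := by
    rw [Complex.mul_conj]; simp
  rw [wavelet_mul_mem hsc, wavelet_mul_mem hsc, map_mul]
  linear_combination wavelet π ψ u g * conj (wavelet π ψ' v g) * h1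

/-- `H` acts by scalars, so `π(g)` and `π(s(x))` commute up to the scalar of their commutator. -/
theorem char_commPart_smul (hs : IsCommutatorSection s)
    (hsc : ∀ (h : H) (v : V), π h v = (χ h⁻¹ : ℂ) • v) (x : G ⧸ H) (g : G) (v : V) :
    (χ (commPart hs x g) : ℂ) • π g v = π (s x) (π g (π (s x)⁻¹ v)) := by
  have h1 : s x * g * (s x)⁻¹ = g * (s x * (((commPart hs x g)⁻¹ : H) * (s x)⁻¹)) := by
    simp [commPart, mul_assoc]
  rw [← map_mul_apply, ← map_mul_apply, h1, map_mul_apply, map_mul_apply, map_mul_apply, hsc,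
    map_smul, map_smul, ← map_mul_apply π (s x), mul_inv_cancel, map_one, inv_inv]
  rfl

/-- Replacing `φ` by `π(s(x))⁻¹ φ` changes a wavelet transform by a phase and a shift of the
analysed vector. -/
theorem wavelet_section_inv (hs : IsCommutatorSection s)
    (hsc : ∀ (h : H) (v : V), π h v = (χ h⁻¹ : ℂ) • v) (φ v : V) (x : G ⧸ H) (g : G) :
    wavelet π (π (s x)⁻¹ φ) v g =
      conj (χ (commPart hs x g) : ℂ) * wavelet π φ (π (s x) v) g := by
  rw [wavelet, wavelet, ← inner_smul_left, char_commPart_smul hs hsc,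
    LinearIsometryEquiv.inner_map_map]

theorem continuous_char_commPart [IsTopologicalGroup G] (hs : IsCommutatorSection s)
    (χ : H →ₜ* Circle) :
    Continuous fun p : (G ⧸ H) × G => (χ (commPart hs p.1 p.2) : ℂ) := by
  have h1 := hs.1.1
  refine continuous_subtype_val.comp (χ.continuous_toFun.comp
    (Continuous.subtype_mk (p := (· ∈ H))
      (f := fun p : (G ⧸ H) × G => p.2⁻¹ * (s p.1)⁻¹ * p.2 * s p.1) ?_ _))
  fun_prop

variable [MeasurableSpace (G ⧸ H)] {μ : Measure (G ⧸ H)}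

theorem memLp_wavelet_section_inv [BorelSpace (G ⧸ H)] [IsTopologicalGroup G]
    [SecondCountableTopology G] (hs : IsCommutatorSection s)
    (hsc : ∀ (h : H) (v : V), π h v = (χ h⁻¹ : ℂ) • v) (hπ : IsIrreducibleRep π)
    (hφ : IsAdmissibleMod π s μ φ) (x : G ⧸ H) (v : V) :
    MemLp (fun y => wavelet π (π (s x)⁻¹ φ) v (s y)) 2 μ := by
  refine (hφ.memLp (π (s x) v)).congr_norm
    ((continuous_wavelet hπ _ v).comp hs.1.1).aestronglyMeasurable
    (Filter.Eventually.of_forall fun y => ?_)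
  rw [wavelet_section_inv hs hsc, norm_mul, RCLike.norm_conj, Circle.norm_coe, one_mul]

variable [SMulInvariantMeasure G (G ⧸ H) μ] [IsFiniteMeasureOnCompacts μ]
variable [IsTopologicalGroup G] [SecondCountableTopology G] [LocallyCompactSpace G]
variable [BorelSpace (G ⧸ H)]

/-- As `X` is an abelian group, its invariant measure is also invariant under inversion. -/
theorem integral_section_inv (hH : IsClosed (H : Set G)) (hμ : μ ≠ 0)
    (hs : IsCommutatorSection s) {F : G → ℂ} (hF : ∀ (g : G) (h : H), F (g * h) = F g) :
    ∫ x, F (s x)⁻¹ ∂μ = ∫ x, F (s x) ∂μ := by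
  have hN := hs.normal
  have := isInvInvariant_quotient hH hμ hs
  have h1 : ∀ x, F (s x)⁻¹ = F (s x⁻¹) := by
    intro x
    have h3 : (s x⁻¹)⁻¹ * (s x)⁻¹ ∈ H := by
      rw [← QuotientGroup.eq, hs.1.2, QuotientGroup.mk_inv, hs.1.2]
    simpa using (hF (s x⁻¹) ⟨_, h3⟩)
  simp_rw [h1]
  exact integral_inv_eq_self (fun x => F (s x)) μ

variable [CompleteSpace V]

/-- The central identity `∫ χ(h(x, g)) ⟨u, π(g) φ⟩ ⟨π(g) φ, v⟩ dg = C Φ(s(x)) ⟨π(s(x)) u, v⟩`,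
where `C` is the constant of the orthogonality relations of `φ` with itself. Conjugation by
`π(s(x))` absorbs the character, so that Schur's lemma applies to the pair of vectors `φ` and
`π(s(x))⁻¹ φ`; the constant for this pair is found by inversion on `X`. -/
theorem integral_char_commPart_mul_wavelet (hH : IsClosed (H : Set G)) (hμ : μ ≠ 0)
    (hs : IsCommutatorSection s)
    (hsc : ∀ (h : H) (v : V), π h v = (χ h⁻¹ : ℂ) • v) (hπ : IsIrreducibleRep π)
    (hφ : IsAdmissibleMod π s μ φ) (hφ1 : ‖φ‖ = 1) {C : ℂ}
    (hC : ∀ u v, inner ℂ (waveletL2 hφ.memLp v) (waveletL2 hφ.memLp u) = C * inner ℂ v u)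
    (x : G ⧸ H) (u v : V) :
    ∫ y, (χ (commPart hs x (s y)) : ℂ) *
        (wavelet π φ u (s y) * conj (wavelet π φ v (s y))) ∂μ =
      C * wavelet π φ φ (s x) * inner ℂ v (π (s x) u) := by
  have hinv := wavelet_mul_conj_wavelet_mul_mem hsc
  have hmem := memLp_wavelet_section_inv hs hsc hπ hφ x
  obtain ⟨c, hc⟩ := exists_inner_waveletL2_eq hs.1 hπ hφ.memLp hmem (hinv _ _)
  have hcC : c = C * wavelet π φ φ (s x) := by
    have h1 := hc φ φ
    have h2 := hC (π (s x)⁻¹ φ) φ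
    rw [inner_waveletL2] at h1 h2
    have h3 : ∫ y, wavelet π φ φ (s y) * conj (wavelet π (π (s x)⁻¹ φ) φ (s y)) ∂μ =
        ∫ y, wavelet π φ (π (s x)⁻¹ φ) (s y) * conj (wavelet π φ φ (s y)) ∂μ := by
      rw [← integral_section_inv hH hμ hs
        (F := fun g => wavelet π φ φ g * conj (wavelet π (π (s x)⁻¹ φ) φ g)) (hinv _ _ _ _)]
      refine integral_congr_ae (Filter.Eventually.of_forall fun y => ?_)
      simp only [wavelet]
      rw [inner_map_left_eq, inner_map_left_eq, inv_inv, inner_conj_symm, inner_conj_symm, mul_comm]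
    rw [← h3, h1, inner_self_eq_norm_sq_to_K, hφ1] at h2
    rw [wavelet, inner_map_left_eq, ← h2]
    simp
  have h4 := hc u (π (s x)⁻¹ v)
  rw [inner_waveletL2, hcC, inner_map_left_eq, inv_inv] at h4
  rw [← h4]
  refine integral_congr_ae (Filter.Eventually.of_forall fun y => ?_)
  have h5 : π (s x) (π (s x)⁻¹ v) = v := by
    rw [← map_mul_apply, mul_inv_cancel, map_one]; rfl
  beta_reduce
  rw [wavelet_section_inv hs hsc, h5, map_mul, Complex.conj_conj]
  ring

end Orthogonality

/-! ### The transform and the relative convolution -/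

section Convolution

open ComplexConjugate

variable {G : Type*} [Group G] [TopologicalSpace G] {H : Subgroup G}
variable {V : Type*} [NormedAddCommGroup V] [InnerProductSpace ℂ V]
variable {π : G →* (V ≃ₗᵢ[ℂ] V)} {s : G ⧸ H → G} {φ : V} {χ : H →ₜ* Circle}
variable [MeasurableSpace (G ⧸ H)] {μ : Measure (G ⧸ H)}

theorem norm_frown_le (hs : IsCommutatorSection s) (χ : H →ₜ* Circle) (k : G ⧸ H → ℂ) (g : G) :
    ‖frown hs χ μ k g‖ ≤ ∫ x, ‖k x‖ ∂μ := by
  refine (norm_integral_le_integral_norm _).trans_eq ?_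
  simp only [norm_mul, Circle.norm_coe, mul_one]

theorem bddAbove_norm_frown (hs : IsCommutatorSection s) (χ : H →ₜ* Circle) (k : G ⧸ H → ℂ) :
    BddAbove (Set.range fun g : G => ‖frown hs χ μ k g‖) :=
  ⟨_, by rintro _ ⟨g, rfl⟩; exact norm_frown_le hs χ k g⟩

variable [IsTopologicalGroup G] [SecondCountableTopology G] [BorelSpace (G ⧸ H)]

theorem continuous_frown (hs : IsCommutatorSection s) (χ : H →ₜ* Circle) {k : G ⧸ H → ℂ}
    (hk : Integrable k μ) : Continuous (frown hs χ μ k) := by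
  have h1 := continuous_char_commPart hs χ
  refine continuous_of_dominated (bound := fun x => ‖k x‖) (fun g => ?_) (fun g => ?_) hk.norm ?_
  · exact hk.aestronglyMeasurable.mul
      (h1.comp (continuous_id.prodMk continuous_const)).aestronglyMeasurable
  · refine Filter.Eventually.of_forall fun x => ?_
    rw [norm_mul, Circle.norm_coe, mul_one]
  · exact Filter.Eventually.of_forall fun x =>
      continuous_const.mul (h1.comp (continuous_const.prodMk continuous_id))

theorem integrable_smul_map (hs : IsContSection s) (hπ : IsIrreducibleRep π) {f : G ⧸ H → ℂ}
    (hf : Integrable f μ) (v : V) : Integrable (fun x => f x • π (s x) v) μ := by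
  refine (hf.norm.mul_const ‖v‖).mono' (hf.aestronglyMeasurable.smul
    ((hπ.continuous v).comp hs.1).aestronglyMeasurable) (Filter.Eventually.of_forall fun x => ?_)
  rw [norm_smul, LinearIsometryEquiv.norm_map]

/-- The relative convolution with an integrable function is a bounded operator. -/
theorem exists_isRelativeConvolution (hs : IsContSection s) (hπ : IsIrreducibleRep π)
    {f : G ⧸ H → ℂ} (hf : Integrable f μ) :
    ∃ T : V →L[ℂ] V, IsRelativeConvolution π s μ f T := by
  let T : V →ₗ[ℂ] V :=
    { toFun := fun v => ∫ x, f x • π (s x) v ∂μ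
      map_add' := fun u v => by
        simp only [map_add, smul_add]
        exact integral_add (integrable_smul_map hs hπ hf u) (integrable_smul_map hs hπ hf v)
      map_smul' := fun c v => by
        simp only [map_smul, smul_comm _ c, RingHom.id_apply]
        exact integral_smul c _ }
  refine ⟨T.mkContinuous (∫ x, ‖f x‖ ∂μ) fun v => ?_, fun v =>
    ⟨integrable_smul_map hs hπ hf v, rfl⟩⟩
  refine (norm_integral_le_integral_norm _).trans_eq ?_
  simp only [norm_smul, LinearIsometryEquiv.norm_map]
  exact integral_mul_const _ _

variable [LocallyCompactSpace G] [SMulInvariantMeasure G (G ⧸ H) μ] [IsFiniteMeasureOnCompacts μ]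
variable [CompleteSpace V]

/-- Up to the constant `C`, the relative convolution `π(k Φ)` is the wavelet transform followed by
the multiplication by `k^⌢` and by the adjoint of the wavelet transform. -/
theorem inner_relativeConvolution (hH : IsClosed (H : Set G)) (hμ : μ ≠ 0)
    (hs : IsCommutatorSection s)
    (hsc : ∀ (h : H) (v : V), π h v = (χ h⁻¹ : ℂ) • v) (hπ : IsIrreducibleRep π)
    (hφ : IsAdmissibleMod π s μ φ) (hφ1 : ‖φ‖ = 1) {C : ℂ}
    (hC : ∀ u v, inner ℂ (waveletL2 hφ.memLp v) (waveletL2 hφ.memLp u) = C * inner ℂ v u)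
    {k : G ⧸ H → ℂ} (hk : Integrable k μ) {f : G ⧸ H → ℂ}
    (hfk : ∀ x, k x * wavelet π φ φ (s x) = f x) {T : V →L[ℂ] V}
    (hT : IsRelativeConvolution π s μ f T) (u v : V) :
    C * inner ℂ v (T u) =
      ∫ y, frown hs χ μ k (s y) * (wavelet π φ u (s y) * conj (wavelet π φ v (s y))) ∂μ := by
  have hmul : Integrable (fun y => wavelet π φ u (s y) * conj (wavelet π φ v (s y))) μ :=
    (hφ.memLp u).integrable_mul (hφ.memLp v).star
  have hprod : Integrable (Function.uncurry fun x y => k x * ((χ (commPart hs x (s y)) : ℂ) *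
      (wavelet π φ u (s y) * conj (wavelet π φ v (s y))))) (μ.prod μ) := by
    have h1 := (hk.mul_prod hmul).bdd_mul (c := 1)
      (f := fun p : (G ⧸ H) × (G ⧸ H) => (χ (commPart hs p.1 (s p.2)) : ℂ))
      ((continuous_char_commPart hs χ).comp
        (continuous_fst.prodMk (hs.1.1.comp continuous_snd))).aestronglyMeasurable
      (Filter.Eventually.of_forall fun p => (Circle.norm_coe _).le)
    refine h1.congr (Filter.Eventually.of_forall fun p => ?_)
    simp only [Function.uncurry]
    ring
  have hswap := integral_integral_swap hprod
  rw [(hT u).2, ← integral_inner (hT u).1, ← integral_const_mul]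
  calc ∫ x, C * inner ℂ v (f x • π (s x) u) ∂μ
      = ∫ x, ∫ y, k x * ((χ (commPart hs x (s y)) : ℂ) *
          (wavelet π φ u (s y) * conj (wavelet π φ v (s y)))) ∂μ ∂μ := by
        refine integral_congr_ae (Filter.Eventually.of_forall fun x => ?_)
        beta_reduce
        rw [integral_const_mul,
          integral_char_commPart_mul_wavelet hH hμ hs hsc hπ hφ hφ1 hC, inner_smul_right, ← hfk]
        ring
    _ = _ := by
        rw [hswap]
        refine integral_congr_ae (Filter.Eventually.of_forall fun y => ?_)
        simp only [frown]
        rw [← integral_mul_const]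
        simp only [mul_assoc]

/-- The wavelet transform is a multiple of an isometry, so that the norm of `π(k Φ)` is at most the
norm of the multiplication by `k^⌢` on `L²(X)`. -/
theorem norm_relativeConvolution_le (hH : IsClosed (H : Set G)) (hμ : μ ≠ 0)
    (hs : IsCommutatorSection s)
    (hsc : ∀ (h : H) (v : V), π h v = (χ h⁻¹ : ℂ) • v) (hπ : IsIrreducibleRep π)
    (hφ : IsAdmissibleMod π s μ φ) (hφ1 : ‖φ‖ = 1)
    (hΦ : ∀ x : G ⧸ H, wavelet π φ φ (s x) ≠ 0)
    {k : G ⧸ H → ℂ} (hk : Integrable k μ) {f : G ⧸ H → ℂ}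
    (hfk : ∀ x, k x * wavelet π φ φ (s x) = f x) {T : V →L[ℂ] V}
    (hT : IsRelativeConvolution π s μ f T) :
    ‖T‖ ≤ ⨆ g : G, ‖frown hs χ μ k g‖ := by
  set M := ⨆ g : G, ‖frown hs χ μ k g‖ with hM
  have hM0 : 0 ≤ M := Real.iSup_nonneg fun _ => norm_nonneg _
  have hkM : ∀ g, ‖frown hs χ μ k g‖ ≤ M := le_ciSup (bddAbove_norm_frown hs χ k)
  set W := waveletL2 hφ.memLp with hW
  obtain ⟨C, hC⟩ := exists_inner_waveletL2_eq hs.1 hπ hφ.memLp hφ.memLp 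
    (wavelet_mul_conj_wavelet_mul_mem hsc φ φ)
  have hWsq : ∀ v, ‖W v‖ ^ 2 = ‖C‖ * ‖v‖ ^ 2 := fun v => by
    have h1 := congrArg norm (hC v v)
    rw [inner_self_eq_norm_sq_to_K, inner_self_eq_norm_sq_to_K] at h1
    simpa using h1
  -- The function `Φ` has no zero on `X`, so it is not null for the nonzero measure `μ`.
  have hC0 : 0 < ‖C‖ := by
    have h1 : W φ ≠ 0 := by
      intro h0
      have h2 := coeFn_waveletL2 hφ.memLp φ
      rw [← hW, h0] at h2
      have h3 : ∀ᵐ x ∂μ, False := by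
        filter_upwards [h2, Lp.coeFn_zero ℂ 2 μ] with x hx hx'
        exact hΦ x (by rw [← hx, hx']; rfl)
      exact hμ (ae_eq_bot.1 (Filter.eventually_false_iff_eq_bot.1 h3))
    have h2 := hWsq φ
    rw [hφ1, one_pow, mul_one] at h2
    rw [← h2]
    positivity
  have hWn : ∀ v, ‖W v‖ = √‖C‖ * ‖v‖ := fun v => by
    rw [← Real.sqrt_sq (norm_nonneg (W v)), hWsq, Real.sqrt_mul hC0.le,
      Real.sqrt_sq (norm_nonneg v)]
  refine T.opNorm_le_bound hM0 fun u => ?_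
  have hMu : MemLp (fun y => frown hs χ μ k (s y) * wavelet π φ u (s y)) 2 μ :=
    (hφ.memLp u).of_le_mul (c := M)
      (((continuous_frown hs χ hk).comp hs.1.1).aestronglyMeasurable.mul
        (hφ.memLp u).aestronglyMeasurable)
      (Filter.Eventually.of_forall fun y => by
        rw [norm_mul]; gcongr; exact hkM _)
  have hle : ‖hMu.toLp‖ ≤ M * ‖W u‖ := by
    refine Lp.norm_le_mul_norm_of_ae_le_mul ?_
    filter_upwards [hMu.coeFn_toLp, coeFn_waveletL2 hφ.memLp u] with y h1 h2
    rw [h1, hW, h2, norm_mul]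
    gcongr
    exact hkM _
  have hinner : C * inner ℂ (T u) (T u) = inner ℂ (W (T u)) hMu.toLp := by
    rw [inner_relativeConvolution hH hμ hs hsc hπ hφ hφ1 hC hk hfk hT, L2.inner_def]
    refine integral_congr_ae ?_
    filter_upwards [hMu.coeFn_toLp, coeFn_waveletL2 hφ.memLp (T u)] with y h1 h2
    rw [h1, hW, h2, RCLike.inner_apply]
    ring
  have hfin : ‖C‖ * ‖T u‖ ^ 2 ≤ ‖C‖ * (‖T u‖ * (M * ‖u‖)) := by
    have h1 := congrArg norm hinner
    rw [inner_self_eq_norm_sq_to_K] at h1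
    have h2 : ‖C‖ * ‖T u‖ ^ 2 = ‖inner ℂ (W (T u)) hMu.toLp‖ := by simpa using h1
    rw [h2]
    calc _ ≤ ‖W (T u)‖ * (M * ‖W u‖) :=
          (norm_inner_le_norm _ _).trans (by gcongr)
      _ = (√‖C‖ * √‖C‖) * (‖T u‖ * (M * ‖u‖)) := by rw [hWn, hWn]; ring
      _ = _ := by rw [Real.mul_self_sqrt hC0.le]
  have h3 := le_of_mul_le_mul_left hfin hC0
  rcases (norm_nonneg (T u)).eq_or_lt with h0 | h0
  · rw [← h0]; positivity
  · rw [pow_two] at h3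
    exact le_of_mul_le_mul_left h3 h0

end Convolution

end RelConv

theorem mainTheorem2
    {E : Type*} [NormedAddCommGroup E] [NormedSpace ℝ E] [FiniteDimensional ℝ E]
    {G : Type*} [TopologicalSpace G] [ChartedSpace E G] [Group G] [LieGroup 𝓘(ℝ, E) ∞ G]
    (hG : RelConv.IsExponential E G)
    (H : Subgroup G) (hH : IsClosed (H : Set G))
    [MeasurableSpace (G ⧸ H)] [BorelSpace (G ⧸ H)]
    (μ : Measure (G ⧸ H)) [SMulInvariantMeasure G (G ⧸ H) μ] [IsFiniteMeasureOnCompacts μ]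
    (hμ : μ ≠ 0)
    (s : G ⧸ H → G) (hs : RelConv.IsCommutatorSection s)
    (χ : H →ₜ* Circle)
    {V : Type*} [NormedAddCommGroup V] [InnerProductSpace ℂ V] [CompleteSpace V]
    (π : G →* (V ≃ₗᵢ[ℂ] V)) (hπ : RelConv.IsIrreducibleRep π)
    (hind : RelConv.IsInducedFrom hs.1 χ μ π)
    (φ : V) (hφ : RelConv.IsAdmissibleMod π s μ φ) (hφ1 : ‖φ‖ = 1)
    (hΦ : ∀ x : G ⧸ H, RelConv.wavelet π φ φ (s x) ≠ 0)
    (f : G ⧸ H → ℂ)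
    (hf : Integrable (fun x => f x * (RelConv.wavelet π φ φ (s x))⁻¹) μ) :
    ∃ T : V →L[ℂ] V, RelConv.IsRelativeConvolution π s μ f T ∧
      BddAbove (Set.range fun g : G =>
        ‖RelConv.frown hs χ μ (fun x => f x * (RelConv.wavelet π φ φ (s x))⁻¹) g‖) ∧
      ‖T‖ ≤ ⨆ g : G,
        ‖RelConv.frown hs χ μ (fun x => f x * (RelConv.wavelet π φ φ (s x))⁻¹) g‖ := by
  -- Of the exponential map only the homeomorphism between `E` and `G` matters.
  obtain ⟨e, -⟩ := hG
  have : IsTopologicalGroup G := topologicalGroup_of_lieGroup 𝓘(ℝ, E) ∞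
  have : SecondCountableTopology G := e.toHomeomorph.symm.secondCountableTopology
  have : LocallyCompactSpace G := e.toHomeomorph.symm.isClosedEmbedding.locallyCompactSpace
  have : ConnectedSpace G := e.toHomeomorph.surjective.connectedSpace e.toHomeomorph.continuous
  have hsc := RelConv.map_eq_char_inv_smul hH hμ hs χ hπ hind hφ hφ1
  have hfk : ∀ x, f x * (RelConv.wavelet π φ φ (s x))⁻¹ * RelConv.wavelet π φ φ (s x) = f x :=
    fun x => inv_mul_cancel_right₀ (hΦ x) _
  have hf1 : Integrable f μ := by
    have h1 := hf.mul_bdd (c := 1)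
      (((RelConv.continuous_wavelet hπ φ φ).comp hs.1.1).aestronglyMeasurable (μ := μ))
      (Filter.Eventually.of_forall fun x => by
        refine (norm_inner_le_norm _ _).trans_eq ?_
        rw [LinearIsometryEquiv.norm_map, hφ1, mul_one])
    exact h1.congr (Filter.Eventually.of_forall hfk)
  obtain ⟨T, hT⟩ := RelConv.exists_isRelativeConvolution hs.1 hπ hf1
  exact ⟨T, hT, RelConv.bddAbove_norm_frown hs χ _,
    RelConv.norm_relativeConvolution_le hH hμ hs hsc hπ hφ hφ1 hΦ hf hfk hT⟩
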